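/- **Conventions.** Let $\Sigma$ be a $2$-polygraph: a set $\Sigma_0$ of $0$-cells, a set $\Sigma_1$ of generating $1$-cells (a directed graph on $\Sigma_0$), and a set $\Sigma_2$ of generating $2$-cells $\varphi : s \Rightarrow t$ between parallel $1$-cells of the free category $\Sigma_1^*$. Let $\Sigma_2^*$ and $\Sigma_2^\top$ be the free $2$-category and the free $(2,1)$-category on $\Sigma$, let $\star_1$ be the composition of $2$-cells along $1$-cells, and let $f^-$ be the $\star_1$-inverse of $f$. A *rewriting step* is a $2$-cell $u\varphi v$ of $\Sigma_2^*$ with $\varphi\in\Sigma_2$ and $u,v$ $1$-cells; a *rewriting sequence* is a finite, possibly empty, sequence of composable rewriting steps. A *globular extension* $\Gamma$ of $\Sigma_2^\top$ is a set of $3$-cells $A : f \Rrightarrow g$ between parallel $2$-cells of $\Sigma_2^\top$; $\equiv_\Gamma$ is the congruence it generates on the $2$-cells of $\Sigma_2^\top$. **Branchings.** A *local branching* is a pair $(f,g)$ of rewriting steps with the same source. It is *aspherical* if $f=g$, and *Peiffer* if it is of the form $(fv,ug)$ for rewriting steps $f:u\Rightarrow u'$ and $g:v\Rightarrow v'$ with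 $uv$ defined. It is *overlapping* if it is not aspherical and neither it nor $(g,f)$ is Peiffer, and *critical* if it is overlapping and minimal for the order $(f,g)\sqsubseteq(wfw',wgw')$ on local branchings. **Labellings.** Let $\psi$ be a map from the rewriting steps of $\Sigma$ to a set $W$ with a well-founded (partial) order $\prec$. A confluence diagram $(f\cdot f', g\cdot g')$ of a local branching $(f,g)$ consists of rewriting sequences $f',g'$ from the targets of $f$ and $g$ to a common target. It is *strictly decreasing* if every label in $f'$ is $\prec\psi(f)$ and every label in $g'$ is $\prec\psi(g)$. The pair $(\Sigma,\psi)$ is *strictly decreasing* if every local branching has a strictly decreasing confluence diagram. The labelling $\psi$ is *compatible with contexts* if, for every strictly decreasing confluence diagram $(f\cdot f',g\cdot g')$ of a local branching and all composable $1$-cells $u_1,u_2$, the diagram $(u_1fu_2\cdot u_1f'u_2,\ u_1gu_2\cdot u_1g'u_2)$ is strictly decreasing. The pair $(\Sigma,\psi)$ is *Peiffer decreasing with respect to* $\Gamma$ if every Peiffer branching $(fv,ug)$, with $f:u\Rightarrow u'$ and $g:v\Rightarrow v'$, has a strictly decreasing confluence diagram $(fv\cdot f',ug\cdot g')$ with $u'g\star_1(fv')^-\equiv_\Gamma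 f'\star_1(g')^-$. **Loops.** A *$2$-loop* is a $2$-cell of $\Sigma_2^*$ whose source and target are equal. Equivalence of $2$-loops is the equivalence relation generated by circular permutation of the steps in a decomposition $f=f_1\star_1\cdots\star_1 f_p$ into rewriting steps. A $2$-loop $f$ is *elementary* if it is not an identity and (i) whenever $f=g\star_1h\star_1k$ in $\Sigma_2^*$ with $h$ a $2$-loop, $h$ is an identity or $h=f$; and (ii) $f$ is not of the form $ugv$ with $g$ a $2$-loop and $u,v$ $1$-cells that are not both identities. **Completion.** A *strictly decreasing Squier completion* $\mathcal S^{sd}(\Sigma,\psi)$ extends $\Sigma$ by the globular extension of $\Sigma_2^\top$ that consists of * exactly one $3$-cell $f\star_1f'\Rrightarrow g\star_1g'$, with $(f\cdot f',g\cdot g')$ a strictly decreasing confluence diagram, for each critical branching $(f,g)$, where $(f,g)$ and $(g,f)$ count as the same branching; and * for exactly one representative $\alpha$ of each equivalence class of $2$-loops that contains an elementary $2$-loop, one $3$-cell $\alpha\Rrightarrow 1_{s_1(\alpha)}$, where $s_1(\alpha)$ is the source of $\alpha$. **Theorem.** Let $(\Sigma,\psi)$ be a strictly decreasing $2$-polygraph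 and let $\mathcal S^{sd}(\Sigma,\psi)$ be a strictly decreasing Squier completion of it. If $\psi$ is compatible with contexts and $(\Sigma,\psi)$ is Peiffer decreasing with respect to $\mathcal S^{sd}(\Sigma,\psi)$, then $\mathcal S^{sd}(\Sigma,\psi)$ is a coherent presentation of the category presented by $\Sigma$ (the quotient of $\Sigma_1^*$ by the congruence generated by $\Sigma_2$): for all parallel $2$-cells $f,g$ of $\Sigma_2^\top$ there is a $3$-cell from $f$ to $g$ in the free $(3,1)$-category generated by $\mathcal S^{sd}(\Sigma,\psi)$. -/

import Mathlib

open CategoryTheory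

universe u v w

/-- A `2`-polygraph: `0`-cells `Ob`, generating `1`-cells (the arrows of a quiver on `Ob`), and a
globular extension of the free category on that quiver. `Cell s t` is the set of generating
`2`-cells with `1`-source `s` and `1`-target `t`; since `s` and `t` are parallel paths, `(s, t)`
is a `1`-sphere. -/
structure TwoPolygraph where
  Ob : Type u
  [quiver : Quiver.{v} Ob]
  Cell : ∀ {x y : Ob}, Quiver.Path x y → Quiver.Path x y → Type w

attribute [instance] TwoPolygraph.quiver

namespace TwoPolygraph

variable (S : TwoPolygraph.{u, v, w})

/-! ### Cells of dimension one, rewriting steps and rewriting sequences -/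

/-- The `1`-cells from `x` to `y` of the free category on the generating `1`-cells. -/
def OneCell (x y : S.Ob) : Type (max u v) := Quiver.Path x y

variable {S}

/-- Composition of `1`-cells. -/
def OneCell.comp {x y z : S.Ob} (p : S.OneCell x y) (q : S.OneCell y z) : S.OneCell x z :=
  Quiver.Path.comp p q

/-- The number of generating `1`-cells in a `1`-cell; it is `0` exactly for the identities. -/
def OneCell.length {x y : S.Ob} (p : S.OneCell x y) : ℕ := Quiver.Path.length p

theorem OneCell.comp_assoc {x y z t : S.Ob} (p : S.OneCell x y) (q : S.OneCell y z)
    (r : S.OneCell z t) : (p.comp q).comp r = p.comp (q.comp r) :=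
  Quiver.Path.comp_assoc p q r

variable (S)

/-- A rewriting step `u φ v : p ⇒ q`, given by a generating `2`-cell `φ : s ⇒ t` and `1`-cells
`u = left`, `v = right` with `p = u s v` and `q = u t v`. -/
@[ext]
structure Step {x y : S.Ob} (p q : S.OneCell x y) where
  {a b : S.Ob}
  left : S.OneCell x a
  {s t : S.OneCell a b}
  cell : S.Cell s t
  right : S.OneCell b y
  source_eq : left.comp (s.comp right) = p
  target_eq : left.comp (t.comp right) = q

variable {S}

theorem Step.mk_eq {x y a b : S.Ob} {p q : S.OneCell x y} {l l' : S.OneCell x a}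
    {s t : S.OneCell a b} {c : S.Cell s t} {r r' : S.OneCell b y} (hl : l = l') (hr : r = r')
    (h₁ : l.comp (s.comp r) = p) (h₂ : l.comp (t.comp r) = q) (h₁' : l'.comp (s.comp r') = p)
    (h₂' : l'.comp (t.comp r') = q) :
    (⟨l, c, r, h₁, h₂⟩ : S.Step p q) = ⟨l', c, r', h₁', h₂'⟩ := by
  subst hl hr
  rfl

/-- The step `f`, with its source and target replaced by equal `1`-cells. -/
def Step.cast {x y : S.Ob} {p q p' q' : S.OneCell x y} (f : S.Step p q) (hp : p = p')
    (hq : q = q') : S.Step p' q' :=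
  ⟨f.left, f.cell, f.right, f.source_eq.trans hp, f.target_eq.trans hq⟩

/-- The step `u f`. -/
def Step.whiskerLeft {x y z : S.Ob} (u : S.OneCell x y) {p q : S.OneCell y z} (f : S.Step p q) :
    S.Step (u.comp p) (u.comp q) :=
  ⟨u.comp f.left, f.cell, f.right, by rw [OneCell.comp_assoc, f.source_eq],
    by rw [OneCell.comp_assoc, f.target_eq]⟩

/-- The step `f v`. -/
def Step.whiskerRight {x y z : S.Ob} {p q : S.OneCell x y} (f : S.Step p q) (v : S.OneCell y z) :
    S.Step (p.comp v) (q.comp v) :=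
  ⟨f.left, f.cell, f.right.comp v,
    by rw [← OneCell.comp_assoc, ← OneCell.comp_assoc, OneCell.comp_assoc f.left, f.source_eq],
    by rw [← OneCell.comp_assoc, ← OneCell.comp_assoc, OneCell.comp_assoc f.left, f.target_eq]⟩

/-- The step `u f v`. -/
def Step.whisker {x y a b : S.Ob} (u : S.OneCell a x) {p q : S.OneCell x y} (f : S.Step p q)
    (v : S.OneCell y b) : S.Step (u.comp (p.comp v)) (u.comp (q.comp v)) :=
  (f.whiskerRight v).whiskerLeft u

/-- The graph of rewriting steps between the `1`-cells from `x` to `y`. -/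
instance stepQuiver (x y : S.Ob) : Quiver (S.OneCell x y) where
  Hom p q := S.Step p q

variable (S)

/-- Finite rewriting sequences from `p` to `q`, possibly empty. -/
abbrev RewSeq {x y : S.Ob} (p q : S.OneCell x y) := Quiver.Path p q

variable {S}

/-- A rewriting step as a rewriting sequence of length one. -/
def Step.toSeq {x y : S.Ob} {p q : S.OneCell x y} (f : S.Step p q) : S.RewSeq p q :=
  Quiver.Path.nil.cons f

/-- The operation `f ↦ u f v` on `1`-cells and rewriting steps. -/
def whiskerPrefunctor {x y a b : S.Ob} (u : S.OneCell a x) (v : S.OneCell y b) :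
    S.OneCell x y ⥤q S.OneCell a b where
  obj p := u.comp (p.comp v)
  map f := Step.whisker u f v

/-- The rewriting sequence `u f v`, obtained from `f` step by step. -/
def RewSeq.whisker {x y a b : S.Ob} (u : S.OneCell a x) {p q : S.OneCell x y}
    (f : S.RewSeq p q) (v : S.OneCell y b) :
    S.RewSeq (u.comp (p.comp v)) (u.comp (q.comp v)) :=
  (whiskerPrefunctor u v).mapPath f

/-! ### The free `2`-category and the free `(2,1)`-category -/

/-- The Peiffer (exchange) relations `f v · u' g ∼ u g · f v'` between rewriting sequences, for
rewriting steps `f : u ⇒ u'` and `g : v ⇒ v'`. -/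
inductive PeifferRel {x z : S.Ob} : HomRel (Paths (S.OneCell x z))
  | exchange {y : S.Ob} {u u' : S.OneCell x y} {v v' : S.OneCell y z}
      (f : S.Step u u') (g : S.Step v v') {p q q' r : S.OneCell x z}
      (hp : u.comp v = p) (hq : u'.comp v = q) (hq' : u.comp v' = q') (hr : u'.comp v' = r) :
      PeifferRel (X := p) (Y := r)
        (((f.whiskerRight v).cast hp hq).toSeq.comp ((g.whiskerLeft u').cast hq hr).toSeq)
        (((g.whiskerLeft u).cast hp hq').toSeq.comp ((f.whiskerRight v').cast hq' hr).toSeq)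

variable (S)

/-- The hom-category from `x` to `y` of the free `2`-category on `S`: its objects are the
`1`-cells, its morphisms are the rewriting sequences modulo the congruence generated by the
Peiffer relations, and its composition is the `1`-composition. -/
abbrev HomCat (x y : S.Ob) := CategoryTheory.Quotient (PeifferRel (S := S) (x := x) (z := y))

/-- The `2`-cells `p ⇒ q` of the free `2`-category on `S`. -/
abbrev TwoCell {x y : S.Ob} (p q : S.OneCell x y) :=
  (⟨p⟩ : S.HomCat x y) ⟶ ⟨q⟩

/-- The hom-groupoid from `x` to `y` of the free `(2,1)`-category on `S`, obtained by formally
inverting all `2`-cells for the `1`-composition. -/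
abbrev HomGpd (x y : S.Ob) := FreeGroupoid (S.HomCat x y)

/-- The `2`-cells `p ⇒ q` of the free `(2,1)`-category on `S`. -/
abbrev InvTwoCell {x y : S.Ob} (p q : S.OneCell x y) :=
  (FreeGroupoid.mk (⟨p⟩ : S.HomCat x y)) ⟶ FreeGroupoid.mk (⟨q⟩ : S.HomCat x y)

variable {S}

/-- The `2`-cell of the free `2`-category given by a rewriting sequence. -/
def RewSeq.toTwoCell {x y : S.Ob} {p q : S.OneCell x y} (f : S.RewSeq p q) : S.TwoCell p q :=
  (CategoryTheory.Quotient.functor (PeifferRel (S := S) (x := x) (z := y))).map (X := p) (Y := q) f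

/-- The `2`-cell of the free `(2,1)`-category given by one of the free `2`-category. -/
def TwoCell.toInv {x y : S.Ob} {p q : S.OneCell x y} (f : S.TwoCell p q) : S.InvTwoCell p q :=
  FreeGroupoid.homMk f

/-- The `2`-cell of the free `(2,1)`-category given by a rewriting sequence. -/
noncomputable def RewSeq.toInv {x y : S.Ob} {p q : S.OneCell x y} (f : S.RewSeq p q) :
    S.InvTwoCell p q :=
  TwoCell.toInv f.toTwoCell

/-- The operation `f ↦ u f v` on rewriting sequences, as a functor. -/
def whiskerPaths {x y a b : S.Ob} (u : S.OneCell a x) (v : S.OneCell y b) :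
    Paths (S.OneCell x y) ⥤ Paths (S.OneCell a b) where
  obj p := (whiskerPrefunctor u v).obj p
  map f := (whiskerPrefunctor u v).mapPath f
  map_id _ := rfl
  map_comp f g := (whiskerPrefunctor u v).mapPath_comp f g

theorem whiskerPaths_rel {x y a b : S.Ob} (u : S.OneCell a x) (v : S.OneCell y b)
    (p q : Paths (S.OneCell x y)) (f g : p ⟶ q) (h : PeifferRel f g) :
    PeifferRel ((whiskerPaths u v).map f) ((whiskerPaths u v).map g) := by
  obtain @⟨y', p₁, p₂, q₁, q₂, f, g, _, _, _, _, rfl, rfl, rfl, rfl⟩ := h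
  have e (r : S.OneCell x y') (s : S.OneCell y' y) :
      (u.comp r).comp (s.comp v) = u.comp ((r.comp s).comp v) := by
    simp only [OneCell.comp_assoc]
  have h₁ {p q : S.OneCell x y'} (f : S.Step p q) (s : S.OneCell y' y) :
      Step.whisker u ((f.whiskerRight s).cast rfl rfl) v =
        ((f.whiskerLeft u).whiskerRight (s.comp v)).cast (e _ _) (e _ _) :=
    Step.mk_eq rfl (OneCell.comp_assoc _ _ _) _ _ _ _
  have h₂ {p q : S.OneCell y' y} (g : S.Step p q) (r : S.OneCell x y') :
      Step.whisker u ((g.whiskerLeft r).cast rfl rfl) v =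
        ((g.whiskerRight v).whiskerLeft (u.comp r)).cast (e _ _) (e _ _) :=
    Step.mk_eq (OneCell.comp_assoc _ _ _).symm rfl _ _ _ _
  have key := PeifferRel.exchange (f.whiskerLeft u) (g.whiskerRight v) (e _ _) (e _ _) (e _ _)
    (e _ _)
  rw [← h₁, ← h₁, ← h₂, ← h₂] at key
  exact key

/-- The operation `f ↦ u f v` on the free `2`-category. -/
def whiskerFunctor {x y a b : S.Ob} (u : S.OneCell a x) (v : S.OneCell y b) :
    S.HomCat x y ⥤ S.HomCat a b :=
  CategoryTheory.Quotient.lift _ (whiskerPaths u v ⋙ CategoryTheory.Quotient.functor _)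
    (fun p q f g h => CategoryTheory.Quotient.sound _ (whiskerPaths_rel u v p q f g h))

/-- The `2`-cell `u f v` of the free `2`-category. -/
def TwoCell.whisker {x y a b : S.Ob} (u : S.OneCell a x) {p q : S.OneCell x y}
    (f : S.TwoCell p q) (v : S.OneCell y b) :
    S.TwoCell (u.comp (p.comp v)) (u.comp (q.comp v)) :=
  (whiskerFunctor u v).map f

/-- The `2`-cell `u f v` of the free `(2,1)`-category. -/
noncomputable def InvTwoCell.whisker {x y a b : S.Ob} (u : S.OneCell a x) {p q : S.OneCell x y}
    (f : S.InvTwoCell p q) (v : S.OneCell y b) :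
    S.InvTwoCell (u.comp (p.comp v)) (u.comp (q.comp v)) :=
  (FreeGroupoid.map (whiskerFunctor u v)).map f

/-! ### Globular extensions and coherent presentations -/

variable (S)

/-- A globular extension of the free `(2,1)`-category on `S`: a set of `3`-cells with a `2`-source
and a `2`-target that are parallel `2`-cells. The pair `(S, Γ)` is a `(3,1)`-polygraph. -/
structure GlobularExtension where
  Cell : Type*
  {x y : Cell → S.Ob}
  {p q : ∀ A : Cell, S.OneCell (x A) (y A)}
  source : ∀ A : Cell, S.InvTwoCell (p A) (q A)
  target : ∀ A : Cell, S.InvTwoCell (p A) (q A)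

variable {S}

namespace GlobularExtension

/-- The union of two families of `3`-cells. -/
def union (Γ Δ : S.GlobularExtension) : S.GlobularExtension where
  Cell := Γ.Cell ⊕ Δ.Cell
  x := Sum.elim Γ.x Δ.x
  y := Sum.elim Γ.y Δ.y
  p A := match A with
    | .inl A => Γ.p A
    | .inr A => Δ.p A
  q A := match A with
    | .inl A => Γ.q A
    | .inr A => Δ.q A
  source A := match A with
    | .inl A => Γ.source A
    | .inr A => Δ.source A
  target A := match A with
    | .inl A => Γ.target A
    | .inr A => Δ.target A

/-- `Γ.Congr f g` is the relation `f ≡_Γ g`: the congruence on the `2`-cells of the free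
`(2,1)`-category generated by the pairs `(source A, target A)`, for `A` in `Γ`. -/
inductive Congr (Γ : S.GlobularExtension) :
    ∀ {x y : S.Ob} {p q : S.OneCell x y}, S.InvTwoCell p q → S.InvTwoCell p q → Prop
  | of (A : Γ.Cell) : Congr Γ (Γ.source A) (Γ.target A)
  | refl {x y : S.Ob} {p q : S.OneCell x y} (f : S.InvTwoCell p q) : Congr Γ f f
  | symm {x y : S.Ob} {p q : S.OneCell x y} {f g : S.InvTwoCell p q} :
      Congr Γ f g → Congr Γ g f
  | trans {x y : S.Ob} {p q : S.OneCell x y} {f g h : S.InvTwoCell p q} :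
      Congr Γ f g → Congr Γ g h → Congr Γ f h
  | comp {x y : S.Ob} {p q r : S.OneCell x y} {f f' : S.InvTwoCell p q} {g g' : S.InvTwoCell q r} :
      Congr Γ f f' → Congr Γ g g' → Congr Γ (f ≫ g) (f' ≫ g')
  | whisker {x y a b : S.Ob} (u : S.OneCell a x) (v : S.OneCell y b) {p q : S.OneCell x y}
      {f g : S.InvTwoCell p q} :
      Congr Γ f g → Congr Γ (InvTwoCell.whisker u f v) (InvTwoCell.whisker u g v)

/-- Expressions for the `3`-cells from `f` to `g` in the free `(3,1)`-category generated by
`(S, Γ)`: they are built from the generating `3`-cells by identities, inverses and composition for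
the `2`-composition, by `1`-composition, and by composition with `1`-cells on both sides.
The `3`-cells of the free `(3,1)`-category are these expressions modulo the axioms of
`(3,1)`-categories, so a `3`-cell from `f` to `g` exists if and only if such an expression does. -/
inductive ThreeCell (Γ : S.GlobularExtension) :
    ∀ {x y : S.Ob} {p q : S.OneCell x y}, S.InvTwoCell p q → S.InvTwoCell p q → Type _
  | of (A : Γ.Cell) : ThreeCell Γ (Γ.source A) (Γ.target A)
  | id {x y : S.Ob} {p q : S.OneCell x y} (f : S.InvTwoCell p q) : ThreeCell Γ f f
  | inv {x y : S.Ob} {p q : S.OneCell x y} {f g : S.InvTwoCell p q} :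
      ThreeCell Γ f g → ThreeCell Γ g f
  | comp₂ {x y : S.Ob} {p q : S.OneCell x y} {f g h : S.InvTwoCell p q} :
      ThreeCell Γ f g → ThreeCell Γ g h → ThreeCell Γ f h
  | comp₁ {x y : S.Ob} {p q r : S.OneCell x y} {f f' : S.InvTwoCell p q}
      {g g' : S.InvTwoCell q r} :
      ThreeCell Γ f f' → ThreeCell Γ g g' → ThreeCell Γ (f ≫ g) (f' ≫ g')
  | whisker {x y a b : S.Ob} (u : S.OneCell a x) (v : S.OneCell y b) {p q : S.OneCell x y}
      {f g : S.InvTwoCell p q} :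
      ThreeCell Γ f g → ThreeCell Γ (InvTwoCell.whisker u f v) (InvTwoCell.whisker u g v)

/-- `Γ` is a homotopy basis: every `2`-sphere `(f, g)` of the free `(2,1)`-category is filled by a
`3`-cell of the free `(3,1)`-category. -/
def IsHomotopyBasis (Γ : S.GlobularExtension) : Prop :=
  ∀ {x y : S.Ob} {p q : S.OneCell x y} (f g : S.InvTwoCell p q), Nonempty (Γ.ThreeCell f g)

end GlobularExtension

variable (S)

/-- The relation on the free category on the generating `1`-cells given by the generating
`2`-cells. -/
def cellRel : HomRel (Paths S.Ob) := fun _ _ p q => Nonempty (S.Cell p q)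

/-- The category presented by `S`: the quotient of the free category on the generating `1`-cells
by the congruence generated by the generating `2`-cells. -/
abbrev PresentedCategory := CategoryTheory.Quotient S.cellRel

/-- `S` is a presentation of the category `C`: the category presented by `S` is isomorphic
to `C`. -/
def IsPresentationOf (C : Type*) [Category* C] : Prop :=
  ∃ (F : S.PresentedCategory ⥤ C) (G : C ⥤ S.PresentedCategory), F ⋙ G = 𝟭 _ ∧ G ⋙ F = 𝟭 _

variable {S}

/-- `(S, Γ)` is a coherent presentation of the category `C`. -/
def GlobularExtension.IsCoherentPresentationOf (Γ : S.GlobularExtension) (C : Type*)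
    [Category* C] : Prop :=
  S.IsPresentationOf C ∧ Γ.IsHomotopyBasis

/-! ### Loops -/

variable (S)

/-- A `2`-loop of the free `2`-category. -/
structure Loop where
  {x y : S.Ob}
  {base : S.OneCell x y}
  cell : S.TwoCell base base

variable {S}

namespace Loop

/-- `f` and `g` are related by a circular permutation of the steps of a decomposition of `f` into
rewriting steps. -/
inductive Rotation : S.Loop → S.Loop → Prop
  | mk {x y : S.Ob} {p q : S.OneCell x y} (h : S.RewSeq p q) (k : S.RewSeq q p) :
      Rotation ⟨RewSeq.toTwoCell (h.comp k)⟩ ⟨RewSeq.toTwoCell (k.comp h)⟩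

variable (S) in
/-- Equivalence classes of `2`-loops, for the equivalence relation generated by circular
permutations. -/
def Class := Quot (Rotation (S := S))

/-- The equivalence class of a `2`-loop. -/
def toClass (f : S.Loop) : Class S := Quot.mk _ f

/-- The `2`-loop is an identity. -/
def IsIdentity (f : S.Loop) : Prop := f.cell = 𝟙 _

/-- The `2`-loop `u g v`. -/
def whisker {a b : S.Ob} (g : S.Loop) (u : S.OneCell a g.x) (v : S.OneCell g.y b) : S.Loop :=
  ⟨TwoCell.whisker u g.cell v⟩

/-- Minimality with respect to `1`-composition. -/
def IsMinimalForComp (f : S.Loop) : Prop :=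
  ∀ (q : S.OneCell f.x f.y) (g : S.TwoCell f.base q) (h : S.TwoCell q q) (k : S.TwoCell q f.base),
    f.cell = g ≫ h ≫ k → IsIdentity ⟨h⟩ ∨ (⟨h⟩ : S.Loop) = f

/-- Minimality by context: `f` is not of the form `u g v` for a `2`-loop `g` and `1`-cells `u`, `v`
that are not both identities. -/
def IsMinimalByContext (f : S.Loop) : Prop :=
  ¬ ∃ (a b : S.Ob) (g : S.Loop) (u : S.OneCell a g.x) (v : S.OneCell g.y b),
    (u.length ≠ 0 ∨ v.length ≠ 0) ∧ f = g.whisker u v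

/-- Elementary `2`-loops: the nonidentity ones that are minimal in both senses. -/
def IsElementary (f : S.Loop) : Prop :=
  ¬ f.IsIdentity ∧ f.IsMinimalForComp ∧ f.IsMinimalByContext

end Loop

variable (S)

/-- The equivalence classes of elementary `2`-loops. -/
def ElementaryClass := {c : Loop.Class S // ∃ f : S.Loop, f.IsElementary ∧ f.toClass = c}

/-- A loop extension of `S`: the choice of exactly one representative of each equivalence class of
elementary `2`-loops. -/
structure LoopExtension where
  rep : S.ElementaryClass → S.Loop
  toClass_rep : ∀ c, (rep c).toClass = c.1

variable {S}

/-- The `3`-cells of a loop extension: one `3`-cell from `α` to the identity for each chosen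
representative `α`. -/
noncomputable def LoopExtension.toGlobularExtension (L : S.LoopExtension) :
    S.GlobularExtension where
  Cell := S.ElementaryClass
  source c := TwoCell.toInv (L.rep c).cell
  target c := 𝟙 (FreeGroupoid.mk (⟨(L.rep c).base⟩ : S.HomCat _ _))

/-! ### Local branchings -/

variable (S)

/-- A local branching: a pair of rewriting steps with the same source. -/
structure LocalBranching where
  {x y : S.Ob}
  {src tgt₁ tgt₂ : S.OneCell x y}
  fst : S.Step src tgt₁
  snd : S.Step src tgt₂

variable {S}

namespace LocalBranching

/-- The branching `(g, f)`, for a branching `(f, g)`. -/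
def swap (b : S.LocalBranching) : S.LocalBranching := ⟨b.snd, b.fst⟩

/-- The branching `(u f v, u g v)`, for a branching `(f, g)`. -/
def whisker (b : S.LocalBranching) {x' y' : S.Ob} (u : S.OneCell x' b.x) (v : S.OneCell b.y y') :
    S.LocalBranching :=
  ⟨Step.whisker u b.fst v, Step.whisker u b.snd v⟩

/-- The Peiffer branching `(f v, u g)` of the steps `f : u ⇒ u'` and `g : v ⇒ v'`. -/
def peiffer {x y z : S.Ob} {u u' : S.OneCell x y} {v v' : S.OneCell y z} (f : S.Step u u')
    (g : S.Step v v') : S.LocalBranching :=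
  ⟨f.whiskerRight v, g.whiskerLeft u⟩

/-- Aspherical branchings `(f, f)`. -/
def IsAspherical (b : S.LocalBranching) : Prop :=
  ∃ (x y : S.Ob) (p q : S.OneCell x y) (f : S.Step p q), b = ⟨f, f⟩

/-- Branchings of the form `(f v, u g)`. -/
def IsPeiffer (b : S.LocalBranching) : Prop :=
  ∃ (x y z : S.Ob) (u u' : S.OneCell x y) (v v' : S.OneCell y z) (f : S.Step u u')
    (g : S.Step v v'), b = peiffer f g

/-- Overlapping branchings: neither aspherical nor, in either order, Peiffer. -/
def IsOverlapping (b : S.LocalBranching) : Prop :=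
  ¬ b.IsAspherical ∧ ¬ b.IsPeiffer ∧ ¬ b.swap.IsPeiffer

/-- The order `(f, g) ⊑ (u f v, u g v)` on local branchings. -/
def ContextLE (b c : S.LocalBranching) : Prop :=
  ∃ (x' y' : S.Ob) (u : S.OneCell x' b.x) (v : S.OneCell b.y y'), c = b.whisker u v

/-- Critical branchings: the overlapping branchings that are minimal for `⊑`. -/
def IsCritical (b : S.LocalBranching) : Prop :=
  b.IsOverlapping ∧ ∀ c : S.LocalBranching, c.ContextLE b → c = b

end LocalBranching

/-- A confluence of the local branching `(f, g)`: rewriting sequences `f'` and `g'` from the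
targets of `f` and `g` to a common target. It gives the confluence diagram `(f · f', g · g')`. -/
structure Confluence (b : S.LocalBranching) where
  {tgt : S.OneCell b.x b.y}
  fst : S.RewSeq b.tgt₁ tgt
  snd : S.RewSeq b.tgt₂ tgt

namespace Confluence

/-- The confluence diagram `(u f v · u f' v, u g v · u g' v)`. -/
def whisker {b : S.LocalBranching} (D : Confluence b) {x' y' : S.Ob} (u : S.OneCell x' b.x)
    (v : S.OneCell b.y y') : Confluence (b.whisker u v) :=
  ⟨RewSeq.whisker u D.fst v, RewSeq.whisker u D.snd v⟩

/-- The rewriting sequence `f · f'` of a confluence diagram `(f · f', g · g')`. -/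
def side₁ {b : S.LocalBranching} (D : Confluence b) : S.RewSeq b.src D.tgt :=
  b.fst.toSeq.comp D.fst

/-- The rewriting sequence `g · g'` of a confluence diagram `(f · f', g · g')`. -/
def side₂ {b : S.LocalBranching} (D : Confluence b) : S.RewSeq b.src D.tgt :=
  b.snd.toSeq.comp D.snd

end Confluence

/-! ### Labellings and decreasingness -/

variable (S)

/-- A labelling of the rewriting steps of `S` in `W`. It is a well-founded labelling when `W`
carries a well-founded order. -/
def Labelling (W : Type*) := ∀ {x y : S.Ob} {p q : S.OneCell x y}, S.Step p q → W

variable {S}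

namespace Labelling

variable {W : Type*}

/-- The set of labels of the steps of a rewriting sequence. -/
def labels (ψ : S.Labelling W) {x y : S.Ob} {p : S.OneCell x y} :
    ∀ {q : S.OneCell x y}, S.RewSeq p q → Set W
  | _, .nil => ∅
  | _, .cons f e => insert (ψ e) (labels ψ f)

variable [PartialOrder W]

/-- The confluence diagram `(f · f', g · g')` is strictly decreasing: the labels of `f'` are less
than the label of `f`, and the labels of `g'` are less than the label of `g`. -/
def IsStrictlyDecreasingDiagram (ψ : S.Labelling W) {b : S.LocalBranching} (D : Confluence b) :
    Prop :=
  (∀ k ∈ ψ.labels D.fst, k < ψ b.fst) ∧ (∀ k ∈ ψ.labels D.snd, k < ψ b.snd)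

/-- `(S, ψ)` is strictly decreasing: every local branching has a strictly decreasing confluence
diagram. -/
def IsStrictlyDecreasing (ψ : S.Labelling W) : Prop :=
  ∀ b : S.LocalBranching, ∃ D : Confluence b, ψ.IsStrictlyDecreasingDiagram D

/-- `ψ` is compatible with contexts: if `(f · f', g · g')` is a strictly decreasing confluence
diagram of a local branching, then so is `(u f v · u f' v, u g v · u g' v)`. -/
def IsCompatibleWithContexts (ψ : S.Labelling W) : Prop :=
  ∀ (b : S.LocalBranching) (D : Confluence b), ψ.IsStrictlyDecreasingDiagram D →
    ∀ (x' y' : S.Ob) (u : S.OneCell x' b.x) (v : S.OneCell b.y y'),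
      ψ.IsStrictlyDecreasingDiagram (D.whisker u v)

/-- `(S, ψ)` is Peiffer decreasing with respect to `Γ`: every Peiffer branching `(f v, u g)` has a
strictly decreasing confluence diagram `(f v · f', u g · g')` with
`u' g ⋆₁ (f v')⁻ ≡_Γ f' ⋆₁ (g')⁻`. -/
def IsPeifferDecreasing (ψ : S.Labelling W) (Γ : S.GlobularExtension) : Prop :=
  ∀ {x y z : S.Ob} {u u' : S.OneCell x y} {v v' : S.OneCell y z} (f : S.Step u u')
    (g : S.Step v v'),
    ∃ D : Confluence (LocalBranching.peiffer f g), ψ.IsStrictlyDecreasingDiagram D ∧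
      Γ.Congr
        ((g.whiskerLeft u').toSeq.toInv ≫ Groupoid.inv (f.whiskerRight v').toSeq.toInv)
        (RewSeq.toInv D.fst ≫ Groupoid.inv (RewSeq.toInv D.snd))

/-- A family of generating strictly decreasing confluences: exactly one strictly decreasing
confluence diagram for each critical branching, the branchings `(f, g)` and `(g, f)` being
regarded as the same one. The set `carrier` chooses one of the two. -/
structure GeneratingConfluences (ψ : S.Labelling W) where
  carrier : Set S.LocalBranching
  critical : ∀ b ∈ carrier, b.IsCritical
  exactly_one : ∀ b : S.LocalBranching, b.IsCritical → Xor (b ∈ carrier) (b.swap ∈ carrier)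
  diagram : ∀ b : carrier, Confluence b.1
  decreasing : ∀ b : carrier, ψ.IsStrictlyDecreasingDiagram (diagram b)

/-- The `3`-cells `f ⋆₁ f' ⇛ g ⋆₁ g'` of a family of generating confluences. -/
noncomputable def GeneratingConfluences.toGlobularExtension {ψ : S.Labelling W}
    (O : ψ.GeneratingConfluences) : S.GlobularExtension where
  Cell := O.carrier
  source b := (O.diagram b).side₁.toInv
  target b := (O.diagram b).side₂.toInv

/-- The strictly decreasing Squier completion given by a family of generating strictly decreasing
confluences and a loop extension. -/
noncomputable def squierCompletion {ψ : S.Labelling W} (O : ψ.GeneratingConfluences)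
    (L : S.LoopExtension) : S.GlobularExtension :=
  O.toGlobularExtension.union L.toGlobularExtension

end Labelling

end TwoPolygraph

/-!
For parallel `2`-cells `f` and `g`, the `2`-cell `f ⋆₁ g⁻` is the value of a closed zigzag of
rewriting steps, to be read cyclically. If two consecutive steps form a local peak, the valley of
a coherent strictly decreasing diagram replaces the peak by a congruent zigzag, with a smaller
multiset of labels for the Dershowitz–Manna order. A cyclic zigzag without local peaks is
directed: it is a `2`-loop or the inverse of one. A `2`-loop that is not elementary either
contains a shorter `2`-loop, whose removal leaves a shorter one too, or is a smaller `2`-loop in a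
context; hence all `2`-loops are congruent to identities as soon as the elementary ones are.
-/

/-! ### Zigzags in a quiver -/

theorem path_eq_nil_or_exists_eq_toPath_comp {V : Type*} [Quiver V] {a b : V}
    (f : Quiver.Path a b) :
    (∃ h : a = b, f = h ▸ .nil) ∨
      ∃ (c : V) (e : a ⟶ c) (f' : Quiver.Path c b), f = e.toPath.comp f' := by
  by_cases hf : f.length = 0
  · obtain rfl := Quiver.Path.eq_of_length_zero f hf
    exact .inl ⟨rfl, Quiver.Path.eq_nil_of_length_zero f hf⟩
  · obtain ⟨c, e, f', rfl, -⟩ := f.length_ne_zero_iff_eq_comp.1 hf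
    exact .inr ⟨c, e, f', rfl⟩

/-- The zigzags from `a` to `b` in a quiver: the paths whose arrows may be followed in either
direction. -/
def ZigzagPath {V : Type*} [Quiver V] (a b : V) := @Quiver.Path (Quiver.Symmetrify V) _ a b

namespace ZigzagPath

variable {V : Type*} [Quiver V] {a b c d : V}

/-- The empty zigzag. -/
def nil : ZigzagPath a a := Quiver.Path.nil

/-- Concatenation of zigzags. -/
def comp (z : ZigzagPath a b) (z' : ZigzagPath b c) : ZigzagPath a c := Quiver.Path.comp z z'

/-- The zigzag traversed backwards. -/
def reverse (z : ZigzagPath a b) : ZigzagPath b a := Quiver.Path.reverse z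

/-- A path of the quiver, as a zigzag all of whose arrows are followed forwards. -/
def ofPath (f : Quiver.Path a b) : ZigzagPath a b := Quiver.Symmetrify.of.mapPath f

/-- The one-arrow zigzag that follows `e` forwards. -/
def pos (e : a ⟶ b) : ZigzagPath a b := ofPath e.toPath

/-- The one-arrow zigzag that follows `e` backwards. -/
def neg (e : a ⟶ b) : ZigzagPath b a := (pos e).reverse

@[simp] theorem comp_nil (z : ZigzagPath a b) : z.comp nil = z := rfl

@[simp] theorem nil_comp (z : ZigzagPath a b) : nil.comp z = z := Quiver.Path.nil_comp z

@[simp] theorem comp_assoc (z : ZigzagPath a b) (z' : ZigzagPath b c) (z'' : ZigzagPath c d) :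
    (z.comp z').comp z'' = z.comp (z'.comp z'') :=
  Quiver.Path.comp_assoc z z' z''

@[simp] theorem reverse_nil : (nil : ZigzagPath a a).reverse = nil := rfl

@[simp] theorem reverse_comp (z : ZigzagPath a b) (z' : ZigzagPath b c) :
    (z.comp z').reverse = z'.reverse.comp z.reverse :=
  Quiver.Path.reverse_comp z z'

@[simp] theorem reverse_pos (e : a ⟶ b) : (pos e).reverse = neg e := rfl

@[simp] theorem reverse_neg (e : a ⟶ b) : (neg e).reverse = pos e := rfl

@[simp] theorem ofPath_nil : ofPath (.nil : Quiver.Path a a) = nil := rfl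

@[simp] theorem ofPath_toPath (e : a ⟶ b) : ofPath e.toPath = pos e := rfl

@[simp] theorem ofPath_comp (f : Quiver.Path a b) (g : Quiver.Path b c) :
    ofPath (f.comp g) = (ofPath f).comp (ofPath g) :=
  Quiver.Symmetrify.of.mapPath_comp f g

theorem ofPath_cons (f : Quiver.Path a b) (e : b ⟶ c) :
    ofPath (f.cons e) = (ofPath f).comp (pos e) := rfl

@[elab_as_elim]
theorem induction {motive : ∀ {b : V}, ZigzagPath a b → Prop} (nil : motive nil)
    (comp_pos : ∀ {b c : V} (z : ZigzagPath a b) (e : b ⟶ c), motive z → motive (z.comp (pos e)))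
    (comp_neg : ∀ {b c : V} (z : ZigzagPath a b) (e : c ⟶ b), motive z → motive (z.comp (neg e)))
    (z : ZigzagPath a b) : motive z := by
  unfold ZigzagPath at z
  induction z with
  | nil => exact nil
  | cons z s ih =>
    rcases s with e | e
    · exact comp_pos z e ih
    · exact comp_neg z e ih

theorem eq_valley_or_exists_peak (z : ZigzagPath a b) :
    (∃ (c : V) (f : Quiver.Path a c) (g : Quiver.Path b c),
      z = (ofPath f).comp (ofPath g).reverse) ∨
    ∃ (c d e : V) (e₁ : c ⟶ d) (e₂ : c ⟶ e) (u : ZigzagPath a d) (v : ZigzagPath e b),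
      z = u.comp (((neg e₁).comp (pos e₂)).comp v) := by
  induction z using ZigzagPath.induction with
  | nil => exact .inl ⟨a, .nil, .nil, rfl⟩
  | @comp_pos b b' z e₂ ih =>
    obtain ⟨c, f, g, rfl⟩ | ⟨c, d, e, e₁, e₂', u, v, rfl⟩ := ih
    · obtain ⟨rfl, rfl⟩ | ⟨d, e₁, g, rfl⟩ := path_eq_nil_or_exists_eq_toPath_comp g
      · exact .inl ⟨b', f.cons e₂, .nil, rfl⟩
      · exact .inr ⟨b, d, b', e₁, e₂, (ofPath f).comp (ofPath g).reverse, nil, by simp⟩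
    · exact .inr ⟨c, d, e, e₁, e₂', u, v.comp (pos e₂), by simp⟩
  | @comp_neg b b' z s ih =>
    obtain ⟨c, f, g, rfl⟩ | ⟨c, d, e, e₁, e₂, u, v, rfl⟩ := ih
    · exact .inl ⟨c, f, s.toPath.comp g, by simp⟩
    · exact .inr ⟨c, d, e, e₁, e₂, u, v.comp (neg s), by simp⟩

/-- A closed zigzag is read cyclically here, so that a peak may also occur at its base point. -/
theorem eq_ofPath_or_exists_cyclic_peak (z : ZigzagPath a a) :
    (∃ f : Quiver.Path a a, z = ofPath f ∨ z = (ofPath f).reverse) ∨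
    ∃ (b c d : V) (e₁ : b ⟶ c) (e₂ : b ⟶ d) (w : ZigzagPath d c) (u : ZigzagPath a c)
      (v : ZigzagPath c a), z = u.comp v ∧ v.comp u = ((neg e₁).comp (pos e₂)).comp w := by
  obtain ⟨b, f, g, rfl⟩ | ⟨b, c, d, e₁, e₂, u, v, rfl⟩ := z.eq_valley_or_exists_peak
  · obtain ⟨rfl, rfl⟩ | ⟨d, e₂, f, rfl⟩ := path_eq_nil_or_exists_eq_toPath_comp f
    · exact .inl ⟨g, .inr (nil_comp _)⟩
    obtain ⟨rfl, rfl⟩ | ⟨c, e₁, g, rfl⟩ := path_eq_nil_or_exists_eq_toPath_comp g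
    · exact .inl ⟨e₂.toPath.comp f, .inl rfl⟩
    exact .inr ⟨a, c, d, e₁, e₂, (ofPath f).comp (ofPath g).reverse,
      (pos e₂).comp ((ofPath f).comp (ofPath g).reverse), neg e₁, by simp, by simp⟩
  · exact .inr ⟨b, c, d, e₁, e₂, v.comp u, u, ((neg e₁).comp (pos e₂)).comp v, rfl, by simp⟩

section Labels

variable {W : Type*} (ψ : ∀ {a b : V}, (a ⟶ b) → W)

/-- The multiset of the labels of the arrows of a zigzag, whatever their direction. -/
def labels (z : ZigzagPath a b) : Multiset W :=
  Quiver.Path.addWeight (V := Quiver.Symmetrify V)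
    (fun s => Sum.elim (fun e => {ψ e}) (fun e => {ψ e}) s) z

@[simp] theorem labels_nil : labels ψ (nil : ZigzagPath a a) = 0 :=
  Quiver.Path.addWeight_nil _ _

@[simp] theorem labels_pos (e : a ⟶ b) : labels ψ (pos e) = {ψ e} :=
  (Quiver.Path.addWeight_cons _ .nil _).trans <|
    (congrArg (· + {ψ e}) (Quiver.Path.addWeight_nil _ _)).trans (zero_add _)

@[simp] theorem labels_neg (e : a ⟶ b) : labels ψ (neg e) = {ψ e} :=
  (Quiver.Path.addWeight_cons _ .nil _).trans <|
    (congrArg (· + {ψ e}) (Quiver.Path.addWeight_nil _ _)).trans (zero_add _)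

@[simp] theorem labels_comp (z : ZigzagPath a b) (z' : ZigzagPath b c) :
    labels ψ (z.comp z') = labels ψ z + labels ψ z' :=
  Quiver.Path.addWeight_comp _ z z'

@[simp] theorem labels_reverse (z : ZigzagPath a b) : labels ψ z.reverse = labels ψ z := by
  induction z using ZigzagPath.induction with
  | nil => rfl
  | comp_pos z e ih => simp [ih, add_comm]
  | comp_neg z e ih => simp [ih, add_comm]

theorem isDershowitzMannaLT_labels_comp [Preorder W] {z z' : ZigzagPath a b}
    (hne : labels ψ z' ≠ 0) (h : ∀ k ∈ labels ψ z, ∃ l ∈ labels ψ z', k < l) (w : ZigzagPath b c) :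
    (labels ψ (z.comp w)).IsDershowitzMannaLT (labels ψ (z'.comp w)) :=
  ⟨labels ψ w, labels ψ z, labels ψ z', hne, by rw [labels_comp, add_comm],
    by rw [labels_comp, add_comm], h⟩

end Labels

section Eval

variable {G : Type*} [Groupoid G] (φ : V ⥤q G)

/-- The value of a zigzag in a groupoid to which the quiver is mapped: the arrows that are followed
backwards are sent to inverses. -/
def eval (z : ZigzagPath a b) : φ.obj a ⟶ φ.obj b := (Paths.lift (Quiver.Symmetrify.lift φ)).map z

@[simp] theorem eval_nil : eval φ (nil : ZigzagPath a a) = 𝟙 _ := rfl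

@[simp] theorem eval_pos (e : a ⟶ b) : eval φ (pos e) = φ.map e := Category.id_comp _

@[simp] theorem eval_neg (e : a ⟶ b) : eval φ (neg e) = Groupoid.inv (φ.map e) :=
  Category.id_comp _

@[simp] theorem eval_comp (z : ZigzagPath a b) (z' : ZigzagPath b c) :
    eval φ (z.comp z') = eval φ z ≫ eval φ z' :=
  (Paths.lift (Quiver.Symmetrify.lift φ)).map_comp z z'

@[simp] theorem eval_reverse (z : ZigzagPath a b) :
    eval φ z.reverse = Groupoid.inv (eval φ z) := by
  induction z using ZigzagPath.induction with
  | nil => simp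
  | comp_pos z e ih => simp [ih]
  | comp_neg z e ih => simp [ih]

end Eval

end ZigzagPath

/-! ### Coherence of decreasing zigzags -/

section Coherence

variable {G : Type*} [Groupoid G] {r : HomRel G} [Congruence r]

theorem homRel_comp_id_comm {X Y : G} {f : X ⟶ Y} {g : Y ⟶ X} (h : r (f ≫ g) (𝟙 X)) :
    r (g ≫ f) (𝟙 Y) := by
  simpa using HomRel.comp_left (Groupoid.inv f) (HomRel.comp_right f h)

theorem homRel_inv_id {X : G} {f : X ⟶ X} (h : r f (𝟙 X)) : r (Groupoid.inv f) (𝟙 X) := by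
  simpa using Congruence.equivalence.symm (HomRel.comp_left (Groupoid.inv f) h)

/-- Well-founded induction on the multiset of labels: rotate the zigzag to start with a peak,
replace this peak by a zigzag with smaller labels, and stop when no peak is left. -/
theorem ZigzagPath.homRel_eval_id {V : Type*} [Quiver V] {W : Type*} [Preorder W]
    [WellFoundedLT W] {φ : V ⥤q G} {ψ : ∀ {a b : V}, (a ⟶ b) → W}
    (hpeak : ∀ {a b c : V} (e₁ : a ⟶ b) (e₂ : a ⟶ c), ∃ z : ZigzagPath b c,
      (∀ k ∈ labels ψ z, k < ψ e₁ ∨ k < ψ e₂) ∧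
        r (Groupoid.inv (φ.map e₁) ≫ φ.map e₂) (eval φ z))
    (hloop : ∀ {a : V} (f : Quiver.Path a a), r (eval φ (ofPath f)) (𝟙 _))
    {a : V} (z : ZigzagPath a a) : r (eval φ z) (𝟙 _) := by
  generalize hM : labels ψ z = M
  induction M using (Multiset.wellFounded_isDershowitzMannaLT (α := W)).induction
    generalizing a with
  | _ M ih =>
  obtain ⟨f, rfl | rfl⟩ | ⟨b, c, d, e₁, e₂, w, u, v, rfl, hvu⟩ := z.eq_ofPath_or_exists_cyclic_peak
  · exact hloop f
  · rw [eval_reverse]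
    exact homRel_inv_id (hloop f)
  obtain ⟨z', hz', hr⟩ := hpeak e₁ e₂
  have hrot : labels ψ (u.comp v) = labels ψ (v.comp u) := by simp only [labels_comp, add_comm]
  have hlt : (labels ψ (z'.comp w)).IsDershowitzMannaLT M := by
    rw [← hM, hrot, hvu]
    exact isDershowitzMannaLT_labels_comp ψ (by simp) (by simpa using hz') w
  have hvalue : r (eval φ (v.comp u)) (𝟙 _) := by
    refine Congruence.equivalence.trans ?_ (ih _ hlt (z'.comp w) rfl)
    rw [hvu, eval_comp, eval_comp, eval_comp, eval_neg, eval_pos]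
    exact HomRel.comp_right _ hr
  rw [eval_comp] at hvalue ⊢
  exact homRel_comp_id_comm hvalue

end Coherence

theorem freeGroupoid_hom_induction {C : Type*} [Category* C]
    {P : ∀ {X Y : C}, (FreeGroupoid.mk X ⟶ FreeGroupoid.mk Y) → Prop}
    (id : ∀ X : C, P (𝟙 (FreeGroupoid.mk X)))
    (comp : ∀ {X Y Z : C} (h : FreeGroupoid.mk X ⟶ FreeGroupoid.mk Y) (f : Y ⟶ Z),
      P h → P (h ≫ FreeGroupoid.homMk f))
    (comp_inv : ∀ {X Y Z : C} (h : FreeGroupoid.mk X ⟶ FreeGroupoid.mk Y) (f : Z ⟶ Y),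
      P h → P (h ≫ Groupoid.inv (FreeGroupoid.homMk f)))
    {X Y : C} (h : FreeGroupoid.mk X ⟶ FreeGroupoid.mk Y) : P h := by
  obtain ⟨⟨h⟩⟩ := h
  change @Quiver.Path (Quiver.Symmetrify C) _ X Y at h
  clear * - id comp comp_inv h
  induction h with
  | nil => exact id X
  | cons p e ih =>
    rcases e with e | e
    · exact comp _ e ih
    · exact comp_inv _ e ih

namespace TwoPolygraph

variable {S : TwoPolygraph.{u, v, w}}

@[simp] theorem OneCell.length_comp {x y z : S.Ob} (p : S.OneCell x y) (q : S.OneCell y z) :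
    (p.comp q).length = p.length + q.length :=
  Quiver.Path.length_comp p q

namespace RewSeq

variable {x y : S.Ob} {p q r : S.OneCell x y}

@[simp] theorem toTwoCell_comp (f : S.RewSeq p q) (g : S.RewSeq q r) :
    toTwoCell (f.comp g) = toTwoCell f ≫ toTwoCell g := rfl

@[simp] theorem toInv_comp (f : S.RewSeq p q) (g : S.RewSeq q r) :
    toInv (f.comp g) = toInv f ≫ toInv g :=
  (FreeGroupoid.of _).map_comp f.toTwoCell g.toTwoCell

theorem toTwoCell_surjective : Function.Surjective (toTwoCell : S.RewSeq p q → S.TwoCell p q) := by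
  rintro ⟨f⟩
  exact ⟨f, rfl⟩

theorem whisker_comp {a b : S.Ob} (u : S.OneCell a x) (f : S.RewSeq p q) (g : S.RewSeq q r)
    (v : S.OneCell y b) : whisker u (f.comp g) v = (whisker u f v).comp (whisker u g v) :=
  (whiskerPrefunctor u v).mapPath_comp f g

end RewSeq

namespace TwoCell

variable {x y : S.Ob} {p q r : S.OneCell x y}

@[simp] theorem toInv_id : toInv (𝟙 _ : S.TwoCell p p) = 𝟙 _ := (FreeGroupoid.of _).map_id _

@[simp] theorem toInv_comp (f : S.TwoCell p q) (g : S.TwoCell q r) :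
    toInv (f ≫ g) = toInv f ≫ toInv g :=
  (FreeGroupoid.of _).map_comp _ _

variable (S) in
/-- The functor that counts the steps of a `2`-cell: the two sides of a Peiffer relation both have
two steps. -/
def lengthFunctor (x y : S.Ob) : S.HomCat x y ⥤ SingleObj (Multiplicative ℕ) :=
  CategoryTheory.Quotient.lift _
    (Paths.lift { obj := fun _ => SingleObj.star _, map := fun _ => Multiplicative.ofAdd 1 })
    (by rintro _ _ _ _ ⟨f, g, _, _, _, _⟩; rfl)

/-- The number of steps of a `2`-cell. -/
def length (f : S.TwoCell p q) : ℕ := Multiplicative.toAdd ((lengthFunctor S x y).map f)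

@[simp] theorem length_comp (f : S.TwoCell p q) (g : S.TwoCell q r) :
    length (f ≫ g) = length f + length g := by
  simp only [length, Functor.map_comp, SingleObj.comp_as_mul]
  exact add_comm _ _

theorem length_toTwoCell (f : S.RewSeq p q) : length f.toTwoCell = Quiver.Path.length f := by
  induction f with
  | nil => rfl
  | cons f e ih =>
    change length (RewSeq.toTwoCell f ≫ (Step.toSeq e).toTwoCell) = _
    rw [length_comp, ih]
    rfl

theorem eq_of_length_eq_zero (f : S.TwoCell p q) (h : length f = 0) : p = q := by
  obtain ⟨f, rfl⟩ := RewSeq.toTwoCell_surjective f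
  exact Quiver.Path.eq_of_length_zero f (length_toTwoCell f ▸ h)

theorem eq_id_of_length_eq_zero (f : S.TwoCell p p) (h : length f = 0) : f = 𝟙 _ := by
  obtain ⟨f, rfl⟩ := RewSeq.toTwoCell_surjective f
  rw [Quiver.Path.eq_nil_of_length_zero f (length_toTwoCell f ▸ h)]
  rfl

theorem length_whisker {a b : S.Ob} (u : S.OneCell a x) (f : S.TwoCell p q) (v : S.OneCell y b) :
    length (whisker u f v) = length f := by
  obtain ⟨f, rfl⟩ := RewSeq.toTwoCell_surjective f
  change length (RewSeq.whisker u f v).toTwoCell = _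
  simp only [length_toTwoCell]
  induction f with
  | nil => rfl
  | cons f _ ih => exact congrArg (· + 1) ih

end TwoCell

/-! ### Zigzags of rewriting steps -/

section Zigzag

variable {x y : S.Ob} {p q : S.OneCell x y}

variable (S) in
/-- The rewriting steps as `2`-cells of the free `(2,1)`-category; its extension to zigzags is
`ZigzagPath.eval (S.stepPrefunctor x y)`. -/
noncomputable def stepPrefunctor (x y : S.Ob) : S.OneCell x y ⥤q S.HomGpd x y where
  obj p := FreeGroupoid.mk ⟨p⟩
  map e := (Step.toSeq e).toInv

theorem eval_ofPath (f : S.RewSeq p q) :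
    (ZigzagPath.ofPath f).eval (S.stepPrefunctor x y) = f.toInv := by
  induction f with
  | nil => exact ((FreeGroupoid.of _).map_id _).symm
  | cons f e ih =>
    change ((ZigzagPath.ofPath f).comp (.pos e)).eval (S.stepPrefunctor x y) =
      RewSeq.toInv (f.comp (Step.toSeq e))
    rw [ZigzagPath.eval_comp, ih, ZigzagPath.eval_pos, RewSeq.toInv_comp]
    rfl

theorem exists_zigzagPath_eval_eq (f : S.InvTwoCell p q) :
    ∃ z : ZigzagPath p q, z.eval (S.stepPrefunctor x y) = f := by
  refine freeGroupoid_hom_induction (C := S.HomCat x y) (P := fun {X Y} f =>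
    ∃ z : ZigzagPath (V := S.OneCell x y) X.as Y.as, z.eval (S.stepPrefunctor x y) = f) ?_ ?_ ?_ f
  · exact fun X => ⟨.nil, rfl⟩
  · rintro X Y Z f k ⟨z, rfl⟩
    obtain ⟨k, rfl⟩ := RewSeq.toTwoCell_surjective (p := Y.as) (q := Z.as) k
    exact ⟨z.comp (.ofPath k), (ZigzagPath.eval_comp _ z _).trans <|
      congrArg (z.eval (S.stepPrefunctor x y) ≫ ·) (eval_ofPath k)⟩
  · rintro X Y Z f k ⟨z, rfl⟩
    obtain ⟨k, rfl⟩ := RewSeq.toTwoCell_surjective (p := Z.as) (q := Y.as) k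
    exact ⟨z.comp (ZigzagPath.ofPath k).reverse, (ZigzagPath.eval_comp _ z _).trans <|
      congrArg (z.eval (S.stepPrefunctor x y) ≫ ·) <|
        (ZigzagPath.eval_reverse _ _).trans (congrArg Groupoid.inv (eval_ofPath k))⟩

end Zigzag

namespace GlobularExtension

variable {Γ : S.GlobularExtension} {x y : S.Ob} {p q r : S.OneCell x y}

theorem congr_comp_left_iff (f : S.InvTwoCell p q) {g g' : S.InvTwoCell q r} :
    Γ.Congr (f ≫ g) (f ≫ g') ↔ Γ.Congr g g' :=
  ⟨fun h => by simpa using (Congr.refl (Groupoid.inv f)).comp h, (Congr.refl f).comp⟩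

theorem congr_comp_right_iff {f f' : S.InvTwoCell p q} (g : S.InvTwoCell q r) :
    Γ.Congr (f ≫ g) (f' ≫ g) ↔ Γ.Congr f f' :=
  ⟨fun h => by simpa using h.comp (.refl (Groupoid.inv g)), fun h => h.comp (.refl g)⟩

theorem congr_comp_inv_id_iff {f g : S.InvTwoCell p q} :
    Γ.Congr (f ≫ Groupoid.inv g) (𝟙 _) ↔ Γ.Congr f g := by
  rw [← congr_comp_right_iff g]
  simp

theorem Congr.nonempty_threeCell {f g : S.InvTwoCell p q} (h : Γ.Congr f g) :
    Nonempty (Γ.ThreeCell f g) := by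
  induction h with
  | of A => exact ⟨.of A⟩
  | refl f => exact ⟨.id f⟩
  | symm _ ih => exact ih.map .inv
  | trans _ _ ih ih' => exact ih.elim fun A => ih'.map A.comp₂
  | comp _ _ ih ih' => exact ih.elim fun A => ih'.map A.comp₁
  | whisker u v _ ih => exact ih.map (.whisker u v)

variable (Γ) in
/-- The congruence `≡_Γ` on the `2`-cells between `1`-cells from `x` to `y`, as a relation on the
morphisms of a hom-groupoid. -/
def homRel (x y : S.Ob) : HomRel (S.HomGpd x y) :=
  fun X Y f g => Γ.Congr (p := X.as.as.as) (q := Y.as.as.as) f g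

instance : Congruence (Γ.homRel x y) where
  equivalence := ⟨Congr.refl, Congr.symm, Congr.trans⟩
  comp_left f _ _ h := (Congr.refl f).comp h
  comp_right g h := Congr.comp h (.refl g)

end GlobularExtension

/-! ### Critical branchings -/

namespace LocalBranching

theorem mk_eq_mk {x y : S.Ob} {p q r p' q' r' : S.OneCell x y} {f : S.Step p q} {g : S.Step p r}
    {f' : S.Step p' q'} {g' : S.Step p' r'} (hp : p = p') (hq : q = q') (hr : r = r')
    (hf : f' = f.cast hp hq) (hg : g' = g.cast hp hr) :
    (⟨f', g'⟩ : S.LocalBranching) = ⟨f, g⟩ := by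
  subst hp hq hr hf hg
  rfl

theorem whisker_nil (b : S.LocalBranching) : b.whisker .nil .nil = b := by
  have e (p : S.OneCell b.x b.y) : p = OneCell.comp .nil (p.comp .nil) :=
    (Quiver.Path.nil_comp p).symm
  have h {p q : S.OneCell b.x b.y} (f : S.Step p q) :
      Step.whisker .nil f .nil = f.cast (e p) (e q) :=
    Step.mk_eq (Quiver.Path.nil_comp _) rfl _ _ _ _
  exact mk_eq_mk _ _ _ (h _) (h _)

theorem whisker_whisker (b : S.LocalBranching) {x₁ y₁ x₂ y₂ : S.Ob} (u₂ : S.OneCell x₂ b.x)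
    (v₂ : S.OneCell b.y y₂) (u₁ : S.OneCell x₁ x₂) (v₁ : S.OneCell y₂ y₁) :
    (b.whisker u₂ v₂).whisker u₁ v₁ = b.whisker (u₁.comp u₂) (v₂.comp v₁) := by
  have e (p : S.OneCell b.x b.y) :
      (u₁.comp u₂).comp (p.comp (v₂.comp v₁)) = u₁.comp ((u₂.comp (p.comp v₂)).comp v₁) := by
    simp only [OneCell.comp_assoc]
  have h {p q : S.OneCell b.x b.y} (f : S.Step p q) :
      Step.whisker u₁ (Step.whisker u₂ f v₂) v₁ =
        (Step.whisker (u₁.comp u₂) f (v₂.comp v₁)).cast (e p) (e q) :=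
    Step.mk_eq (OneCell.comp_assoc _ _ _).symm (OneCell.comp_assoc _ _ _) _ _ _ _
  exact mk_eq_mk _ _ _ (h _) (h _)

theorem whisker_peiffer {x y z x' y' : S.Ob} {p p' : S.OneCell x y} {q q' : S.OneCell y z}
    (f : S.Step p p') (g : S.Step q q') (u : S.OneCell x' x) (v : S.OneCell z y') :
    (peiffer f g).whisker u v = peiffer (f.whiskerLeft u) (g.whiskerRight v) := by
  have e (r : S.OneCell x y) (s : S.OneCell y z) :
      (u.comp r).comp (s.comp v) = u.comp ((r.comp s).comp v) := by
    simp only [OneCell.comp_assoc]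
  have h₁ : Step.whisker u (f.whiskerRight q) v =
      ((f.whiskerLeft u).whiskerRight (q.comp v)).cast (e _ _) (e _ _) :=
    Step.mk_eq rfl (OneCell.comp_assoc _ _ _) _ _ _ _
  have h₂ : Step.whisker u (g.whiskerLeft p) v =
      ((g.whiskerRight v).whiskerLeft (u.comp p)).cast (e _ _) (e _ _) :=
    Step.mk_eq (OneCell.comp_assoc _ _ _).symm rfl _ _ _ _
  exact mk_eq_mk _ _ _ h₁ h₂

theorem IsAspherical.whisker {b : S.LocalBranching} (h : b.IsAspherical) {x' y' : S.Ob}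
    (u : S.OneCell x' b.x) (v : S.OneCell b.y y') : (b.whisker u v).IsAspherical := by
  obtain ⟨_, _, _, _, f, rfl⟩ := h
  exact ⟨_, _, _, _, f.whisker u v, rfl⟩

theorem IsPeiffer.whisker {b : S.LocalBranching} (h : b.IsPeiffer) {x' y' : S.Ob}
    (u : S.OneCell x' b.x) (v : S.OneCell b.y y') : (b.whisker u v).IsPeiffer := by
  obtain ⟨x, y, z, p, p', q, q', f, g, rfl⟩ := h
  exact ⟨_, _, _, _, _, _, _, _, _, whisker_peiffer f g u v⟩

theorem IsOverlapping.of_whisker {b : S.LocalBranching} {x' y' : S.Ob}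
    {u : S.OneCell x' b.x} {v : S.OneCell b.y y'} (h : (b.whisker u v).IsOverlapping) :
    b.IsOverlapping :=
  ⟨fun hb => h.1 (hb.whisker u v), fun hb => h.2.1 (hb.whisker u v),
    fun hb => h.2.2 (hb.whisker (b := b.swap) u v)⟩

theorem length_src_whisker (b : S.LocalBranching) {x' y' : S.Ob} (u : S.OneCell x' b.x)
    (v : S.OneCell b.y y') :
    (b.whisker u v).src.length = u.length + (b.src.length + v.length) := by
  change (u.comp (b.src.comp v)).length = _
  simp

theorem whisker_eq_self_of_length {b : S.LocalBranching} {x' y' : S.Ob} (u : S.OneCell x' b.x)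
    (v : S.OneCell b.y y') (hu : u.length = 0) (hv : v.length = 0) : b.whisker u v = b := by
  obtain rfl := Quiver.Path.eq_of_length_zero u hu
  obtain rfl := Quiver.Path.eq_of_length_zero v hv
  obtain rfl := Quiver.Path.eq_nil_of_length_zero u hu
  obtain rfl := Quiver.Path.eq_nil_of_length_zero v hv
  exact whisker_nil b

theorem IsOverlapping.exists_isCritical {b : S.LocalBranching} (h : b.IsOverlapping) :
    ∃ c : S.LocalBranching, c.IsCritical ∧ c.ContextLE b := by
  classical
  have hex : ∃ n, ∃ c : S.LocalBranching, c.IsOverlapping ∧ c.ContextLE b ∧ c.src.length = n :=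
    ⟨_, b, h, ⟨_, _, .nil, .nil, (whisker_nil b).symm⟩, rfl⟩
  obtain ⟨c, hc, ⟨x₁, y₁, u₁, v₁, rfl⟩, hn⟩ := Nat.find_spec hex
  refine ⟨c, ⟨hc, ?_⟩, ⟨_, _, u₁, v₁, rfl⟩⟩
  rintro d ⟨x₂, y₂, u₂, v₂, rfl⟩
  have hle := Nat.find_min' hex ⟨d, hc.of_whisker, ⟨_, _, _, _, whisker_whisker _ _ _ _ _⟩, rfl⟩
  rw [← hn, length_src_whisker] at hle
  exact (whisker_eq_self_of_length u₂ v₂ (by omega) (by omega)).symm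

end LocalBranching

/-! ### Coherently decreasing branchings -/

namespace GlobularExtension

variable {Γ : S.GlobularExtension} {b : S.LocalBranching}

theorem congr_side_iff (D : Confluence b) :
    Γ.Congr D.side₁.toInv D.side₂.toInv ↔
      Γ.Congr (Groupoid.inv b.fst.toSeq.toInv ≫ b.snd.toSeq.toInv)
        (D.fst.toInv ≫ Groupoid.inv D.snd.toInv) := by
  rw [← congr_comp_left_iff b.fst.toSeq.toInv, ← congr_comp_right_iff D.snd.toInv]
  simp only [Confluence.side₁, Confluence.side₂, RewSeq.toInv_comp, Category.assoc,
    Groupoid.inv_eq_inv, IsIso.hom_inv_id_assoc, IsIso.inv_hom_id, Category.comp_id]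
  exact ⟨.symm, .symm⟩

theorem Congr.whisker_side {D : Confluence b} (h : Γ.Congr D.side₁.toInv D.side₂.toInv)
    {x' y' : S.Ob} (u : S.OneCell x' b.x) (v : S.OneCell b.y y') :
    Γ.Congr (D.whisker u v).side₁.toInv (D.whisker u v).side₂.toInv := by
  have whisker_side₁ : (D.whisker u v).side₁ = RewSeq.whisker u D.side₁ v :=
    (RewSeq.whisker_comp u b.fst.toSeq D.fst v).symm
  have whisker_side₂ : (D.whisker u v).side₂ = RewSeq.whisker u D.side₂ v :=
    (RewSeq.whisker_comp u b.snd.toSeq D.snd v).symm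
  rw [whisker_side₁, whisker_side₂]
  exact h.whisker u v

end GlobularExtension

theorem RewSeq.toInv_exchange {x y z : S.Ob} {p p' : S.OneCell x y} {q q' : S.OneCell y z}
    (f : S.Step p p') (g : S.Step q q') :
    (f.whiskerRight q).toSeq.toInv ≫ (g.whiskerLeft p').toSeq.toInv =
      (g.whiskerLeft p).toSeq.toInv ≫ (f.whiskerRight q').toSeq.toInv := by
  rw [← RewSeq.toInv_comp, ← RewSeq.toInv_comp]
  exact congrArg TwoCell.toInv
    (CategoryTheory.Quotient.sound _ (PeifferRel.exchange f g rfl rfl rfl rfl))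

namespace Labelling

theorem mem_labels_ofPath {W : Type*} (ψ : S.Labelling W) {x y : S.Ob} {p q : S.OneCell x y}
    (f : S.RewSeq p q) {k : W} :
    k ∈ (ZigzagPath.ofPath f).labels (fun e => ψ e) ↔ k ∈ ψ.labels f := by
  induction f with
  | nil => simp [labels]
  | cons f e ih => simp [ZigzagPath.ofPath_cons, labels, ih, or_comm]

variable {W : Type*} [PartialOrder W] {ψ : S.Labelling W} {Γ : S.GlobularExtension}
  {b : S.LocalBranching}

/-- The local branching has a strictly decreasing confluence diagram that is filled by `Γ`. -/
def IsCoherentlyDecreasingAt (ψ : S.Labelling W) (Γ : S.GlobularExtension)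
    (b : S.LocalBranching) : Prop :=
  ∃ D : Confluence b, ψ.IsStrictlyDecreasingDiagram D ∧ Γ.Congr D.side₁.toInv D.side₂.toInv

namespace IsCoherentlyDecreasingAt

theorem swap (h : ψ.IsCoherentlyDecreasingAt Γ b) : ψ.IsCoherentlyDecreasingAt Γ b.swap := by
  obtain ⟨D, ⟨h₁, h₂⟩, hD⟩ := h
  exact ⟨⟨D.snd, D.fst⟩, ⟨h₂, h₁⟩, hD.symm⟩

theorem whisker (hψ : ψ.IsCompatibleWithContexts) (h : ψ.IsCoherentlyDecreasingAt Γ b)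
    {x' y' : S.Ob} (u : S.OneCell x' b.x) (v : S.OneCell b.y y') :
    ψ.IsCoherentlyDecreasingAt Γ (b.whisker u v) := by
  obtain ⟨D, hD, hΓ⟩ := h
  exact ⟨D.whisker u v, hψ b D hD _ _ u v, hΓ.whisker_side u v⟩

theorem of_isAspherical (h : b.IsAspherical) : ψ.IsCoherentlyDecreasingAt Γ b := by
  obtain ⟨_, _, _, _, f, rfl⟩ := h
  exact ⟨⟨.nil, .nil⟩, ⟨fun _ hk => hk.elim, fun _ hk => hk.elim⟩, .refl _⟩

theorem of_isPeiffer (hψ : ψ.IsPeifferDecreasing Γ) (h : b.IsPeiffer) :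
    ψ.IsCoherentlyDecreasingAt Γ b := by
  obtain ⟨x, y, z, p, p', q, q', f, g, rfl⟩ := h
  obtain ⟨D, hD, hΓ⟩ := hψ f g
  refine ⟨D, hD, (GlobularExtension.congr_side_iff D).2 ?_⟩
  have peak_eq_valley :
      Groupoid.inv (f.whiskerRight q).toSeq.toInv ≫ (g.whiskerLeft p).toSeq.toInv =
        (g.whiskerLeft p').toSeq.toInv ≫ Groupoid.inv (f.whiskerRight q').toSeq.toInv := by
    rw [Groupoid.inv_eq_inv, Groupoid.inv_eq_inv, IsIso.inv_comp_eq, ← Category.assoc,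
      IsIso.eq_comp_inv, RewSeq.toInv_exchange]
  exact peak_eq_valley ▸ hΓ

theorem of_forall_isCritical (hctx : ψ.IsCompatibleWithContexts)
    (hpeiffer : ψ.IsPeifferDecreasing Γ)
    (hcrit : ∀ c : S.LocalBranching, c.IsCritical → ψ.IsCoherentlyDecreasingAt Γ c) :
    ψ.IsCoherentlyDecreasingAt Γ b := by
  by_cases haspherical : b.IsAspherical
  · exact of_isAspherical haspherical
  by_cases hb : b.IsPeiffer
  · exact of_isPeiffer hpeiffer hb
  by_cases hswap : b.swap.IsPeiffer
  · exact (of_isPeiffer hpeiffer hswap).swap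
  obtain ⟨c, hc, _, _, u, v, rfl⟩ :=
    LocalBranching.IsOverlapping.exists_isCritical ⟨haspherical, hb, hswap⟩
  exact (hcrit c hc).whisker hctx u v

theorem squierCompletion_of_isCritical (O : ψ.GeneratingConfluences) (L : S.LoopExtension)
    (hb : b.IsCritical) : ψ.IsCoherentlyDecreasingAt (squierCompletion O L) b := by
  have of_mem_carrier (c : O.carrier) : ψ.IsCoherentlyDecreasingAt (squierCompletion O L) c.1 :=
    ⟨O.diagram c, O.decreasing c,
      GlobularExtension.Congr.of (Γ := squierCompletion O L) (Sum.inl c)⟩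
  obtain ⟨hmem, -⟩ | ⟨hmem, -⟩ := O.exactly_one b hb
  · exact of_mem_carrier ⟨b, hmem⟩
  · exact (of_mem_carrier ⟨b.swap, hmem⟩).swap

theorem exists_zigzagPath {x y : S.Ob} {p q r : S.OneCell x y} {e₁ : S.Step p q}
    {e₂ : S.Step p r} (h : ψ.IsCoherentlyDecreasingAt Γ ⟨e₁, e₂⟩) :
    ∃ z : ZigzagPath q r, (∀ k ∈ z.labels (fun e => ψ e), k < ψ e₁ ∨ k < ψ e₂) ∧
      Γ.Congr (Groupoid.inv e₁.toSeq.toInv ≫ e₂.toSeq.toInv) (z.eval (S.stepPrefunctor x y)) := by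
  obtain ⟨D, ⟨hfst, hsnd⟩, hΓ⟩ := h
  refine ⟨(ZigzagPath.ofPath D.fst).comp (ZigzagPath.ofPath D.snd).reverse, fun k hk => ?_, ?_⟩
  · rw [ZigzagPath.labels_comp, ZigzagPath.labels_reverse, Multiset.mem_add, mem_labels_ofPath,
      mem_labels_ofPath] at hk
    exact hk.imp (hfst k) (hsnd k)
  · rw [ZigzagPath.eval_comp, ZigzagPath.eval_reverse, eval_ofPath, eval_ofPath]
    exact (GlobularExtension.congr_side_iff D).1 hΓ

end IsCoherentlyDecreasingAt

end Labelling

/-! ### Contractible loops -/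

namespace Loop

variable {Γ : S.GlobularExtension} {f g : S.Loop}

/-- The `2`-loop is filled by the `3`-cells generated by `Γ`: it is congruent to an identity. -/
def IsContractible (Γ : S.GlobularExtension) (f : S.Loop) : Prop :=
  Γ.Congr (TwoCell.toInv f.cell) (𝟙 _)

theorem IsIdentity.isContractible (hf : f.IsIdentity) : f.IsContractible Γ := by
  rw [IsContractible, hf, TwoCell.toInv_id]
  exact .refl _

theorem Rotation.isContractible_iff (h : Rotation f g) :
    f.IsContractible Γ ↔ g.IsContractible Γ := by
  obtain @⟨x, y, _, _, h, k⟩ := h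
  simp only [IsContractible, RewSeq.toTwoCell_comp, TwoCell.toInv_comp]
  exact ⟨homRel_comp_id_comm (r := Γ.homRel x y), homRel_comp_id_comm (r := Γ.homRel x y)⟩

theorem isContractible_iff_of_toClass_eq (h : f.toClass = g.toClass) :
    f.IsContractible Γ ↔ g.IsContractible Γ := by
  replace h := Quot.eqvGen_exact h
  induction h with
  | rel _ _ h => exact h.isContractible_iff
  | refl _ => rfl
  | symm _ _ _ ih => exact ih.symm
  | trans _ _ _ _ _ ih ih' => exact ih.trans ih'

theorem IsContractible.whisker (hg : g.IsContractible Γ) {a b : S.Ob} (u : S.OneCell a g.x)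
    (v : S.OneCell g.y b) : (g.whisker u v).IsContractible Γ := by
  have whisker_id : InvTwoCell.whisker u (𝟙 _ : S.InvTwoCell g.base g.base) v = 𝟙 _ :=
    (FreeGroupoid.map (whiskerFunctor u v)).map_id _
  have congr_whisker_id := GlobularExtension.Congr.whisker u v hg
  rwa [whisker_id] at congr_whisker_id

theorem IsContractible.insert {x y : S.Ob} {p q : S.OneCell x y} {g : S.TwoCell p q}
    {h : S.TwoCell q q} {k : S.TwoCell q p} (hh : IsContractible Γ ⟨h⟩)
    (hgk : IsContractible Γ ⟨g ≫ k⟩) : IsContractible Γ ⟨g ≫ h ≫ k⟩ := by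
  refine .trans ?_ hgk
  simp only [TwoCell.toInv_comp]
  simpa using (GlobularExtension.Congr.refl (TwoCell.toInv g)).comp
    (hh.comp (.refl (TwoCell.toInv k)))

theorem exists_shorter_of_not_isMinimalForComp (hf : ¬ f.IsMinimalForComp) :
    ∃ (q : S.OneCell f.x f.y) (g : S.TwoCell f.base q) (h : S.TwoCell q q)
      (k : S.TwoCell q f.base), f.cell = g ≫ h ≫ k ∧ h.length < f.cell.length ∧
        TwoCell.length (g ≫ k) < f.cell.length := by
  obtain @⟨x, y, p, f⟩ := f
  simp only [IsMinimalForComp, not_forall, not_or] at hf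
  obtain ⟨q, g, h, k, hf, hid, hne⟩ := hf
  change f = g ≫ h ≫ k at hf
  subst hf
  have length_h_ne_zero : h.length ≠ 0 := fun h0 => hid (h.eq_id_of_length_eq_zero h0)
  have length_context_ne_zero : g.length + k.length ≠ 0 := by
    intro h0
    obtain rfl := g.eq_of_length_eq_zero (by omega)
    obtain rfl := g.eq_id_of_length_eq_zero (by omega)
    obtain rfl := k.eq_id_of_length_eq_zero (by omega)
    simp at hne
  refine ⟨q, g, h, k, rfl, ?_, ?_⟩ <;> simp only [TwoCell.length_comp] <;> omega

theorem exists_smaller_of_not_isMinimalByContext (hf : ¬ f.IsMinimalByContext) :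
    ∃ (a b : S.Ob) (g : S.Loop) (u : S.OneCell a g.x) (v : S.OneCell g.y b),
      f = g.whisker u v ∧ g.cell.length = f.cell.length ∧ g.base.length < f.base.length := by
  obtain ⟨a, b, g, u, v, huv, rfl⟩ := not_not.1 hf
  refine ⟨a, b, g, u, v, rfl, (TwoCell.length_whisker u g.cell v).symm, ?_⟩
  change g.base.length < (u.comp (g.base.comp v)).length
  simp only [OneCell.length_comp]
  omega

theorem isContractible_of_forall_isElementary
    (hΓ : ∀ f : S.Loop, f.IsElementary → f.IsContractible Γ) (f : S.Loop) :
    f.IsContractible Γ := by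
  by_cases hid : f.IsIdentity
  · exact hid.isContractible
  by_cases hcomp : f.IsMinimalForComp
  · by_cases hctx : f.IsMinimalByContext
    · exact hΓ f ⟨hid, hcomp, hctx⟩
    · obtain ⟨a, b, g, u, v, hf, hlength, hbase⟩ := exists_smaller_of_not_isMinimalByContext hctx
      exact hf ▸ (isContractible_of_forall_isElementary hΓ g).whisker u v
  · obtain ⟨q, g, h, k, hf, hh, hgk⟩ := exists_shorter_of_not_isMinimalForComp hcomp
    have hinsert := (isContractible_of_forall_isElementary hΓ ⟨h⟩).insert
      (isContractible_of_forall_isElementary hΓ ⟨g ≫ k⟩)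
    rwa [← hf] at hinsert
termination_by (f.cell.length, f.base.length)
decreasing_by
  · exact Prod.lex_def.2 (.inr ⟨hlength, hbase⟩)
  · exact Prod.Lex.left _ _ hh
  · exact Prod.Lex.left _ _ hgk

theorem isContractible_squierCompletion {W : Type*} [PartialOrder W] {ψ : S.Labelling W}
    (O : ψ.GeneratingConfluences) (L : S.LoopExtension) (f : S.Loop) :
    f.IsContractible (Labelling.squierCompletion O L) :=
  isContractible_of_forall_isElementary (fun f hf =>
    (isContractible_iff_of_toClass_eq (L.toClass_rep _)).1 <|
      GlobularExtension.Congr.of (Γ := Labelling.squierCompletion O L)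
        (Sum.inr ⟨f.toClass, f, hf, rfl⟩)) f

end Loop

theorem Labelling.isHomotopyBasis_of_isCoherentlyDecreasingAt {W : Type*} [PartialOrder W]
    [WellFoundedLT W] {ψ : S.Labelling W} {Γ : S.GlobularExtension}
    (hloc : ∀ b, ψ.IsCoherentlyDecreasingAt Γ b) (hloop : ∀ f : S.Loop, f.IsContractible Γ) :
    Γ.IsHomotopyBasis := by
  intro x y p q f g
  obtain ⟨z, hz⟩ := exists_zigzagPath_eval_eq (f ≫ Groupoid.inv g)
  have sphere : Γ.homRel x y (z.eval (S.stepPrefunctor x y)) (𝟙 _) :=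
    z.homRel_eval_id (ψ := fun e => ψ e) (fun e₁ e₂ => (hloc ⟨e₁, e₂⟩).exists_zigzagPath)
      fun {a} f => by rw [eval_ofPath]; exact hloop ⟨RewSeq.toTwoCell f⟩
  rw [hz] at sphere
  exact (GlobularExtension.congr_comp_inv_id_iff.1 sphere).nonempty_threeCell

end TwoPolygraph

theorem mainTheorem1 (S : TwoPolygraph.{u, v, w}) (W : Type*) [PartialOrder W] [WellFoundedLT W]
    (ψ : S.Labelling W) (hψ : ψ.IsStrictlyDecreasing)
    (O : ψ.GeneratingConfluences) (L : S.LoopExtension)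
    (hctx : ψ.IsCompatibleWithContexts)
    (hpeiffer : ψ.IsPeifferDecreasing (TwoPolygraph.Labelling.squierCompletion O L)) :
    (TwoPolygraph.Labelling.squierCompletion O L).IsCoherentPresentationOf
      S.PresentedCategory := by
  have hloc (b : S.LocalBranching) :
      ψ.IsCoherentlyDecreasingAt (TwoPolygraph.Labelling.squierCompletion O L) b :=
    .of_forall_isCritical hctx hpeiffer fun _ => .squierCompletion_of_isCritical O L
  exact ⟨⟨𝟭 _, 𝟭 _, rfl, rfl⟩,
    TwoPolygraph.Labelling.isHomotopyBasis_of_isCoherentlyDecreasingAt hloc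
      (TwoPolygraph.Loop.isContractible_squierCompletion O L)⟩
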